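/- Let $v_E,v_1,v_2,\bar x$ be reals with $0<v_E<v_1<v_2$ and $\bar x>0$, and put $\gamma_i=v_E/v_i$, $\gamma=v_1/v_2$. An evader $E$ and two pursuers $P_1,P_2$ move in the plane with dynamics $\dot x=v\cos\theta$, $\dot y=v\sin\theta$, where $v=v_E,v_1,v_2$ respectively and the controls are the (measurable) headings $\theta(t)\in[-\pi,\pi]$; they start in $\Omega=[0,\bar x]\times[0,\infty)$. The evader wins if it reaches the goal line $G=[0,\bar x]\times\{0\}$, moving in $\Omega$, before its position coincides with that of a pursuer; the pursuers win if such a capture takes place before $E$ has been on $G$ (capture at the instant of arrival counts for the pursuers). Let $\mathcal R_p$ be the set of states from which the pursuer team has a non-anticipative strategy that wins against every control of the evader, let $\mathcal R_e$ be the set of states from which the evader has a control that wins against all motions of the pursuers, and let the Barrier surface be the common boundary $\overline{\mathcal R_e}\cap\overline{\mathcal R_p}$ of the two winning sets. Fix $P_1=(x_1,y_1)$ and $P_2=(x_2,y_2)$ in $\Omega$ such that $P_1$ can reach the left end $(0,0)$ of the goal line no later than $P_2$, and $P_2$ can reach the right end $(\bar x,0)$ no later than $P_1$. Put $$x_I=\frac{x_1-\gamma^2x_2+\sqrt{\gamma^2(x_1-x_2)^2-(1-\gamma^2)(y_1^2-\gamma^2y_2^2)}}{1-\gamma^2}.$$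 Then $0\le x_I\le\bar x$, and the cross-section of the Barrier surface, i.e. the set of positions $(x,y)$ of the evader for which the state is on the Barrier surface, consists exactly of the points $(x,y)\in\Omega$ with $$\begin{array}{ll} x^2+y^2=\gamma_1^2(x_1^2+y_1^2) & \text{if } x\le\gamma_1^2x_1,\\ \gamma_1^2x^2-(1-\gamma_1^2)y^2-2\gamma_1^2x_1x+\gamma_1^2\big(x_1^2+(1-\gamma_1^2)y_1^2\big)=0 & \text{if } \gamma_1^2x_1<x\le(1-\gamma_1^2)x_I+\gamma_1^2x_1,\\ (x-x_I)^2+y^2=\gamma_1^2\big((x_1-x_I)^2+y_1^2\big) & \text{if } (1-\gamma_1^2)x_I+\gamma_1^2x_1<x\le(1-\gamma_2^2)x_I+\gamma_2^2x_2,\\ \gamma_2^2x^2-(1-\gamma_2^2)y^2-2\gamma_2^2x_2x+\gamma_2^2\big(x_2^2+(1-\gamma_2^2)y_2^2\big)=0 & \text{if } (1-\gamma_2^2)x_I+\gamma_2^2x_2<x\le(1-\gamma_2^2)\bar x+\gamma_2^2x_2,\\ (x-\bar x)^2+y^2=\gamma_2^2\big((x_2-\bar x)^2+y_2^2\big) &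 \text{if } x>(1-\gamma_2^2)\bar x+\gamma_2^2x_2. \end{array}$$ If $y_1>0$, the first and the third curve are circles with centers $(0,0)$ and $(x_I,0)$, and the second is a hyperbola; if $y_2>0$, the fifth curve is a circle with center $(\bar x,0)$, and the fourth is a hyperbola. The first and the fifth curve are different; the first and the third are different if $x_I>0$, the third and the fifth if $x_I<\bar x$; the second and the fourth are different. The second (fourth) curve is the set of the evader positions $X$ for which the Apollonius circle $\{Z:|Z-X|=\gamma_i|Z-P_i|\}$ with $i=1$ ($i=2$) is tangent to the axis $y=0$, i.e. meets it in exactly one point. -/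

import Mathlib

open MeasureTheory

noncomputable section

namespace FootballGame

/-- The Euclidean plane in which the three players move. -/
abbrev Plane := EuclideanSpace ℝ (Fin 2)

/-- A state of the game: the positions of the evader, of the first pursuer and of the second
pursuer, in this order. -/
abbrev State := Plane × Plane × Plane

/-- The playing region `[0, xbar] × [0, ∞)`. -/
def field (xbar : ℝ) : Set Plane := {X | 0 ≤ X 0 ∧ X 0 ≤ xbar ∧ 0 ≤ X 1}

/-- The goal line: the points of the playing region with vanishing second coordinate. -/
def goal (xbar : ℝ) : Set Plane := {X | X ∈ field xbar ∧ X 1 = 0}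

/-- The states in which all the players are in the playing region. -/
def playStates (xbar : ℝ) : Set State :=
  {s | s.1 ∈ field xbar ∧ s.2.1 ∈ field xbar ∧ s.2.2 ∈ field xbar}

/-- Admissible controls: measurable heading angles in `[-π, π]` (only times `t ≥ 0` matter). -/
def IsHeading (φ : ℝ → ℝ) : Prop := Measurable φ ∧ ∀ t, φ t ∈ Set.Icc (-Real.pi) Real.pi

/-- The solution of `x' = v cos φ`, `y' = v sin φ` that starts at `p`. -/
def trajectory (v : ℝ) (p : Plane) (φ : ℝ → ℝ) (t : ℝ) : Plane :=
  !₂[p 0 + v * ∫ s in (0 : ℝ)..t, Real.cos (φ s), p 1 + v * ∫ s in (0 : ℝ)..t, Real.sin (φ s)]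

/-- Point capture: one of the pursuers is at the position of the evader at time `t`. -/
def CapturedAt (vE v₁ v₂ : ℝ) (s : State) (φ ψ₁ ψ₂ : ℝ → ℝ) (t : ℝ) : Prop :=
  trajectory v₁ s.2.1 ψ₁ t = trajectory vE s.1 φ t ∨
    trajectory v₂ s.2.2 ψ₂ t = trajectory vE s.1 φ t

/-- The evader reaches the goal line through the playing region, and no capture occurs up to
and including the time of arrival. -/
def EvaderWinsPlay (vE v₁ v₂ xbar : ℝ) (s : State) (φ ψ₁ ψ₂ : ℝ → ℝ) : Prop :=
  ∃ T : ℝ, 0 ≤ T ∧ trajectory vE s.1 φ T ∈ goal xbar ∧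
    ∀ t ∈ Set.Icc 0 T,
      trajectory vE s.1 φ t ∈ field xbar ∧ ¬ CapturedAt vE v₁ v₂ s φ ψ₁ ψ₂ t

/-- The evader is captured at a time before which it has not been on the goal line. -/
def PursuersWinPlay (vE v₁ v₂ xbar : ℝ) (s : State) (φ ψ₁ ψ₂ : ℝ → ℝ) : Prop :=
  ∃ T : ℝ, 0 ≤ T ∧ CapturedAt vE v₁ v₂ s φ ψ₁ ψ₂ T ∧
    ∀ t ∈ Set.Ico 0 T, trajectory vE s.1 φ t ∉ goal xbar

/-- A non-anticipative strategy of the pursuer team: it answers a heading of the evader by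
headings of the two pursuers, and the answer up to time `t` depends only on the evader's heading
up to time `t` (controls are compared almost everywhere). -/
def IsNonanticipative (β : (ℝ → ℝ) → (ℝ → ℝ) × (ℝ → ℝ)) : Prop :=
  (∀ φ, IsHeading φ → IsHeading (β φ).1 ∧ IsHeading (β φ).2) ∧
  ∀ φ φ', IsHeading φ → IsHeading φ' → ∀ t : ℝ, 0 ≤ t →
    (∀ᵐ s ∂(volume.restrict (Set.Icc 0 t)), φ s = φ' s) →
    ∀ᵐ s ∂(volume.restrict (Set.Icc 0 t)), (β φ).1 s = (β φ').1 s ∧ (β φ).2 s = (β φ').2 s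

/-- The winning set of the pursuer team: some non-anticipative strategy of the team captures the
evader before it reaches the goal line, whatever the evader does. -/
def pursuerRegion (vE v₁ v₂ xbar : ℝ) : Set State :=
  {s | s ∈ playStates xbar ∧ ∃ β, IsNonanticipative β ∧
    ∀ φ, IsHeading φ → PursuersWinPlay vE v₁ v₂ xbar s φ (β φ).1 (β φ).2}

/-- The winning set of the evader: it can force its arrival at the goal line before capture,
against all motions of the pursuers (hence against all their strategies, whatever information
these use). -/
def evaderRegion (vE v₁ v₂ xbar : ℝ) : Set State :=
  {s | s ∈ playStates xbar ∧ ∃ φ, IsHeading φ ∧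
    ∀ ψ₁ ψ₂, IsHeading ψ₁ → IsHeading ψ₂ → EvaderWinsPlay vE v₁ v₂ xbar s φ ψ₁ ψ₂}

/-- The Barrier surface: the common boundary of the two winning sets (a set of states of the
game, because the set `playStates` is closed). -/
def barrier (vE v₁ v₂ xbar : ℝ) : Set State :=
  closure (evaderRegion vE v₁ v₂ xbar) ∩ closure (pursuerRegion vE v₁ v₂ xbar)

/-- The cross-section of a set of states for given positions of the pursuers. -/
def crossSection (S : Set State) (P₁ P₂ : Plane) : Set Plane := {X | (X, P₁, P₂) ∈ S}

/-- The circle with center `(c, 0)` whose radius is `γ` times the distance from `P` to `(c, 0)`. -/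
def goalCircle (γ c : ℝ) (P : Plane) : Set Plane :=
  {X | (X 0 - c) ^ 2 + X 1 ^ 2 = γ ^ 2 * ((P 0 - c) ^ 2 + P 1 ^ 2)}

/-- The curve `γ²x² - (1 - γ²)y² - 2γ²px + γ²(p² + (1 - γ²)q²) = 0`, where `P = (p, q)`. -/
def tangencyCurve (γ : ℝ) (P : Plane) : Set Plane :=
  {X | γ ^ 2 * X 0 ^ 2 - (1 - γ ^ 2) * X 1 ^ 2 - 2 * γ ^ 2 * P 0 * X 0
    + γ ^ 2 * (P 0 ^ 2 + (1 - γ ^ 2) * P 1 ^ 2) = 0}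

/-- The Apollonius circle of an evader at `X` and a pursuer at `P`, for the speed ratio `γ`. -/
def apolloniusCircle (γ : ℝ) (P X : Plane) : Set Plane := {Z | dist Z X = γ * dist Z P}

/-- The first coordinate of the right one of the points of the axis `y = 0` that pursuers at
`P₁` and `P₂` with speed ratio `γ = v₁ / v₂` reach simultaneously. -/
def xI (γ : ℝ) (P₁ P₂ : Plane) : ℝ :=
  (P₁ 0 - γ ^ 2 * P₂ 0 +
    √(γ ^ 2 * (P₁ 0 - P₂ 0) ^ 2 - (1 - γ ^ 2) * (P₁ 1 ^ 2 - γ ^ 2 * P₂ 1 ^ 2))) / (1 - γ ^ 2)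

/-- A set of the plane is a (nondegenerate) circle with center `c`. -/
def IsCircle (C : Set Plane) (c : Plane) : Prop := ∃ r : ℝ, 0 < r ∧ C = Metric.sphere c r

/-- A set of the plane is a (nondegenerate) hyperbola. -/
def IsHyperbola (H : Set Plane) : Prop :=
  ∃ (F F' : Plane) (a : ℝ), 0 < a ∧ 2 * a < dist F F' ∧
    H = {X | |dist X F - dist X F'| = 2 * a}

end FootballGame

end

open FootballGame

/-! The game reduces to comparing arrival times on the goal line. If the evader can reach some goal
point strictly before both pursuers, it wins by running straight there (`mem_evaderRegion`). If
every goal point is reached strictly earlier by some pursuer, parallel pursuit wins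
(`mem_pursuerRegion`): until capture it keeps the evader in the Apollonius disc of each pursuer
(`exists_parallel_pursuit`). The winning sets are disjoint, and moving players upwards makes weak
inequalities strict, so the barrier is given by the weak inequalities (`mem_barrier_iff`).

For fixed positions let `Fᵢ(g)` be the `margin` of pursuer `i` at `(g, 0)`, a concave parabola in
`g`. The barrier condition says that the maximum over `[0, xbar]` of `min F₁ F₂` is zero. The
evader's position cancels in the sign of `F₁ - F₂`, so the minimum is `F₁` up to `xᵢ` and `F₂`
beyond it (`xI_spec`). The maximum is attained at `0`, at the vertex of `F₁`, at `xᵢ`, at the vertex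
of `F₂` or at `xbar`, depending on where the vertices lie. An endpoint or crossing gives a circle; a
vertex gives a tangency curve, because the vertex value is a positive multiple of the discriminant
`tangency`. -/

theorem FootballGame.dist_sq_eq (A B : Plane) :
    dist A B ^ 2 = (A 0 - B 0) ^ 2 + (A 1 - B 1) ^ 2 := by
  rw [EuclideanSpace.dist_eq, Real.sq_sqrt (by positivity), Fin.sum_univ_two, Real.dist_eq,
    Real.dist_eq, sq_abs, sq_abs]

/-! ### Trajectories and the speed bound -/

/-- The planar triangle inequality for integrals, in coordinates. -/
theorem sq_integral_add_sq_integral_le {f g h : ℝ → ℝ} {t : ℝ} (ht : 0 ≤ t)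
    (hf : IntervalIntegrable f volume 0 t) (hg : IntervalIntegrable g volume 0 t)
    (hh : IntervalIntegrable h volume 0 t) (hpos : ∀ s, 0 ≤ h s)
    (hfg : ∀ s, f s ^ 2 + g s ^ 2 ≤ h s ^ 2) :
    (∫ s in (0 : ℝ)..t, f s) ^ 2 + (∫ s in (0 : ℝ)..t, g s) ^ 2
      ≤ (∫ s in (0 : ℝ)..t, h s) ^ 2 := by
  set A := ∫ s in (0 : ℝ)..t, f s with hA
  set B := ∫ s in (0 : ℝ)..t, g s with hB
  have hH0 : 0 ≤ ∫ s in (0 : ℝ)..t, h s := intervalIntegral.integral_nonneg ht fun s _ => hpos s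
  set R := √(A ^ 2 + B ^ 2) with hR
  have hR2 : R ^ 2 = A ^ 2 + B ^ 2 := Real.sq_sqrt (by positivity)
  have hR0 : 0 ≤ R := Real.sqrt_nonneg _
  -- Project `(f, g)` onto the direction of its own integral `(A, B)` and apply Cauchy–Schwarz
  -- pointwise.
  have key : (∫ s in (0 : ℝ)..t, (A * f s + B * g s)) ≤ ∫ s in (0 : ℝ)..t, R * h s := by
    refine intervalIntegral.integral_mono_on ht ((hf.const_mul A).add (hg.const_mul B))
      (hh.const_mul R) fun s _ => ?_
    refine abs_le_of_sq_le_sq' ?_ (mul_nonneg hR0 (hpos s)) |>.2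
    rw [mul_pow, hR2]
    nlinarith [sq_nonneg (A * g s - B * f s), hfg s, sq_nonneg A, sq_nonneg B]
  rw [intervalIntegral.integral_add (hf.const_mul A) (hg.const_mul B),
    intervalIntegral.integral_const_mul, intervalIntegral.integral_const_mul,
    intervalIntegral.integral_const_mul, ← hA, ← hB] at key
  have hRH : R ≤ ∫ s in (0 : ℝ)..t, h s := by
    rcases hR0.eq_or_lt with h0 | h0
    · rw [← h0]; exact hH0
    · exact le_of_mul_le_mul_left (by nlinarith) h0
  rw [← hR2]
  exact pow_le_pow_left₀ hR0 hRH 2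

theorem intervalIntegrable_of_measurable_bounded {f : ℝ → ℝ} (hf : Measurable f) {C : ℝ}
    (hC : ∀ s, |f s| ≤ C) (a b : ℝ) : IntervalIntegrable f volume a b := by
  refine (intervalIntegrable_const (c := C)).mono_fun hf.aestronglyMeasurable ?_
  refine Filter.Eventually.of_forall fun s => ?_
  exact (hC s).trans (le_abs_self C)

namespace FootballGame

theorem IsHeading.intervalIntegrable_cos {φ : ℝ → ℝ} (hφ : IsHeading φ) (a b : ℝ) :
    IntervalIntegrable (fun s => Real.cos (φ s)) volume a b :=
  intervalIntegrable_of_measurable_bounded (Real.measurable_cos.comp hφ.1)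
    (fun _ => Real.abs_cos_le_one _) a b

theorem IsHeading.intervalIntegrable_sin {φ : ℝ → ℝ} (hφ : IsHeading φ) (a b : ℝ) :
    IntervalIntegrable (fun s => Real.sin (φ s)) volume a b :=
  intervalIntegrable_of_measurable_bounded (Real.measurable_sin.comp hφ.1)
    (fun _ => Real.abs_sin_le_one _) a b

theorem IsHeading.sq_integral_le {φ : ℝ → ℝ} (hφ : IsHeading φ) {t : ℝ} (ht : 0 ≤ t) :
    (∫ s in (0 : ℝ)..t, Real.cos (φ s)) ^ 2 + (∫ s in (0 : ℝ)..t, Real.sin (φ s)) ^ 2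
      ≤ t ^ 2 := by
  have := sq_integral_add_sq_integral_le ht (hφ.intervalIntegrable_cos 0 t)
    (hφ.intervalIntegrable_sin 0 t) (intervalIntegrable_const (c := (1 : ℝ)))
    (fun _ => zero_le_one) (fun s => by rw [Real.cos_sq_add_sin_sq]; norm_num)
  simpa using this

theorem trajectory_zero (v : ℝ) (p : Plane) (φ : ℝ → ℝ) (t : ℝ) :
    trajectory v p φ t 0 = p 0 + v * ∫ s in (0 : ℝ)..t, Real.cos (φ s) := rfl

theorem trajectory_one (v : ℝ) (p : Plane) (φ : ℝ → ℝ) (t : ℝ) :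
    trajectory v p φ t 1 = p 1 + v * ∫ s in (0 : ℝ)..t, Real.sin (φ s) := rfl

theorem dist_trajectory_le {v : ℝ} (hv : 0 ≤ v) (p : Plane) {φ : ℝ → ℝ} (hφ : IsHeading φ)
    {t : ℝ} (ht : 0 ≤ t) : dist (trajectory v p φ t) p ≤ v * t := by
  refine abs_le_of_sq_le_sq' ?_ (mul_nonneg hv ht) |>.2
  rw [dist_sq_eq]
  simp only [trajectory_zero, trajectory_one]
  nlinarith [hφ.sq_integral_le ht, mul_le_mul_of_nonneg_left (hφ.sq_integral_le ht) (sq_nonneg v)]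

/-! ### Parallel pursuit -/

/-- A measurable choice of a heading with a prescribed direction. -/
theorem exists_heading_of_unit {d₁ d₂ : ℝ → ℝ} (h₁ : Measurable d₁) (h₂ : Measurable d₂)
    (h : ∀ u, d₁ u ^ 2 + d₂ u ^ 2 = 1) :
    ∃ η : ℝ → ℝ, Measurable η ∧ (∀ u, η u ∈ Set.Icc (-Real.pi) Real.pi) ∧
      ∀ u, Real.cos (η u) = d₁ u ∧ Real.sin (η u) = d₂ u := by
  have hz : ∀ u, (⟨d₁ u, d₂ u⟩ : ℂ) = (d₁ u : ℂ) + d₂ u * Complex.I := fun u => by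
    apply Complex.ext <;> simp
  have hn : ∀ u, ‖(⟨d₁ u, d₂ u⟩ : ℂ)‖ = 1 := fun u => by
    have : ‖(⟨d₁ u, d₂ u⟩ : ℂ)‖ ^ 2 = 1 := by
      rw [← Complex.normSq_eq_norm_sq, Complex.normSq_mk, ← h u]; ring
    nlinarith [norm_nonneg (⟨d₁ u, d₂ u⟩ : ℂ)]
  have h0 : ∀ u, (⟨d₁ u, d₂ u⟩ : ℂ) ≠ 0 := fun u h0 => by
    have := hn u
    rw [h0, norm_zero] at this
    exact zero_ne_one this
  refine ⟨fun u => Complex.arg ⟨d₁ u, d₂ u⟩, ?_, fun u => ?_, fun u => ⟨?_, ?_⟩⟩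
  · refine Complex.measurable_arg.comp ?_
    simp_rw [hz]
    fun_prop
  · exact ⟨(Complex.neg_pi_lt_arg _).le, Complex.arg_le_pi _⟩
  · rw [Complex.cos_arg (h0 u), hn]; simp
  · rw [Complex.sin_arg, hn]; simp

set_option maxHeartbeats 1000000 in
/-- Parallel pursuit: a heading that depends only on the current heading of the evader, keeps the
line of sight parallel to its initial direction, captures the evader, and until the capture
confines the evader to the initial Apollonius disc. -/
theorem exists_parallel_pursuit {vE v : ℝ} (hvE : 0 < vE) (hv : vE < v) (X P : Plane) :
    ∃ η : ℝ → ℝ, Measurable η ∧ (∀ u, η u ∈ Set.Icc (-Real.pi) Real.pi) ∧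
      ∀ φ, IsHeading φ → ∃ T : ℝ, 0 ≤ T ∧
        trajectory v P (fun s => η (φ s)) T = trajectory vE X φ T ∧
        ∀ t ∈ Set.Ico 0 T,
          v * dist X (trajectory vE X φ t) ≤ vE * dist P (trajectory vE X φ t) := by
  by_cases hXP : X = P
  · subst hXP
    refine ⟨fun _ => 0, measurable_const, fun _ => ⟨by linarith [Real.pi_pos], Real.pi_pos.le⟩,
      fun φ _ => ⟨0, le_rfl, ?_, fun t ht => absurd ht.2 (not_lt.2 ht.1)⟩⟩
    simp [trajectory]
  have hv0 : 0 < v := hvE.trans hv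
  set L := dist X P with hLdef
  have hL : 0 < L := dist_pos.2 hXP
  have hL2 : L ^ 2 = (X 0 - P 0) ^ 2 + (X 1 - P 1) ^ 2 := dist_sq_eq X P
  -- `(c, s)` is the unit vector along the initial line of sight from `P` to `X`.
  obtain ⟨c, hc⟩ : ∃ c, c = (X 0 - P 0) / L := ⟨_, rfl⟩
  obtain ⟨s, hs⟩ : ∃ s, s = (X 1 - P 1) / L := ⟨_, rfl⟩
  have hc' : X 0 - P 0 = L * c := by rw [hc]; field_simp
  have hs' : X 1 - P 1 = L * s := by rw [hs]; field_simp
  have hcs : c ^ 2 + s ^ 2 = 1 := by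
    rw [hc', hs'] at hL2
    have : L ^ 2 * (c ^ 2 + s ^ 2) = L ^ 2 * 1 := by linarith
    exact mul_left_cancel₀ (by positivity) this
  -- `κ` and `σ` are the components of the evader's heading along and across the line of sight. The
  -- pursuer copies the transverse velocity `vE * σ` and spends the rest of its speed, `ρ`, along
  -- the line.
  obtain ⟨σ, hσ⟩ : ∃ σ : ℝ → ℝ, σ = fun u => c * Real.sin u - s * Real.cos u := ⟨_, rfl⟩
  obtain ⟨κ, hκ⟩ : ∃ κ : ℝ → ℝ, κ = fun u => c * Real.cos u + s * Real.sin u := ⟨_, rfl⟩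
  have hκσ : ∀ u, κ u ^ 2 + σ u ^ 2 = 1 := fun u => by
    rw [hκ, hσ]
    calc _ = (c ^ 2 + s ^ 2) * (Real.sin u ^ 2 + Real.cos u ^ 2) := by ring
      _ = 1 := by rw [hcs, Real.sin_sq_add_cos_sq, one_mul]
  have hσm : Measurable σ := by rw [hσ]; fun_prop
  obtain ⟨ρ, hρ⟩ : ∃ ρ : ℝ → ℝ, ρ = fun u => √(v ^ 2 - vE ^ 2 * σ u ^ 2) := ⟨_, rfl⟩
  have hρm : Measurable ρ := by rw [hρ]; fun_prop
  have hρ0 : ∀ u, 0 ≤ ρ u := fun u => by rw [hρ]; exact Real.sqrt_nonneg _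
  have hρ2 : ∀ u, ρ u ^ 2 = v ^ 2 - vE ^ 2 * σ u ^ 2 := fun u => by
    rw [hρ]
    refine Real.sq_sqrt ?_
    nlinarith [hκσ u, sq_nonneg (κ u), mul_nonneg (sq_nonneg vE) (sq_nonneg (κ u))]
  obtain ⟨η, hηm, hηmem, hη⟩ := exists_heading_of_unit
    (d₁ := fun u => (c * ρ u - s * (vE * σ u)) / v)
    (d₂ := fun u => (s * ρ u + c * (vE * σ u)) / v) (by fun_prop) (by fun_prop) (fun u => by
      rw [div_pow, div_pow, ← add_div, div_eq_one_iff_eq (by positivity)]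
      calc _ = (c ^ 2 + s ^ 2) * (ρ u ^ 2 + vE ^ 2 * σ u ^ 2) := by ring
        _ = v ^ 2 := by rw [hcs, hρ2]; ring)
  refine ⟨η, hηm, hηmem, fun φ hφ => ?_⟩
  have hρle : ∀ u, |ρ u| ≤ v := fun u => by
    refine abs_le_of_sq_le_sq ?_ hv0.le
    rw [hρ2]; nlinarith [mul_nonneg (sq_nonneg vE) (sq_nonneg (σ u))]
  have hρi : ∀ a b, IntervalIntegrable (fun τ => ρ (φ τ)) volume a b :=
    intervalIntegrable_of_measurable_bounded (hρm.comp hφ.1) fun _ => hρle _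
  have hCi := hφ.intervalIntegrable_cos
  have hSi := hφ.intervalIntegrable_sin
  set K : ℝ → ℝ := fun t => ∫ τ in (0 : ℝ)..t, Real.cos (φ τ) with hK
  set S : ℝ → ℝ := fun t => ∫ τ in (0 : ℝ)..t, Real.sin (φ τ) with hS
  set R : ℝ → ℝ := fun t => ∫ τ in (0 : ℝ)..t, ρ (φ τ) with hR
  have hcosη : ∀ t, v * (∫ τ in (0 : ℝ)..t, Real.cos (η (φ τ)))
      = c * R t - s * (vE * (c * S t - s * K t)) := fun t => by
    rw [← intervalIntegral.integral_const_mul]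
    calc _ = ∫ τ in (0 : ℝ)..t, (c * ρ (φ τ) -
          (s * vE * c * Real.sin (φ τ) - s * vE * s * Real.cos (φ τ))) := by
          refine intervalIntegral.integral_congr fun τ _ => ?_
          simp only [(hη (φ τ)).1, hσ]
          field_simp
      _ = _ := by
          rw [intervalIntegral.integral_sub ((hρi 0 t).const_mul _)
            (((hSi 0 t).const_mul _).sub ((hCi 0 t).const_mul _)),
            intervalIntegral.integral_sub ((hSi 0 t).const_mul _) ((hCi 0 t).const_mul _)]
          simp only [intervalIntegral.integral_const_mul, hR, hS, hK]
          ring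
  have hsinη : ∀ t, v * (∫ τ in (0 : ℝ)..t, Real.sin (η (φ τ)))
      = s * R t + c * (vE * (c * S t - s * K t)) := fun t => by
    rw [← intervalIntegral.integral_const_mul]
    calc _ = ∫ τ in (0 : ℝ)..t, (s * ρ (φ τ) +
          (c * vE * c * Real.sin (φ τ) - c * vE * s * Real.cos (φ τ))) := by
          refine intervalIntegral.integral_congr fun τ _ => ?_
          simp only [(hη (φ τ)).2, hσ]
          field_simp
      _ = _ := by
          rw [intervalIntegral.integral_add ((hρi 0 t).const_mul _)
            (((hSi 0 t).const_mul _).sub ((hCi 0 t).const_mul _)),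
            intervalIntegral.integral_sub ((hSi 0 t).const_mul _) ((hCi 0 t).const_mul _)]
          simp only [intervalIntegral.integral_const_mul, hR, hS, hK]
          ring
  -- The signed length of the line of sight: evader minus pursuer is `l t • (c, s)` at time `t`.
  set l : ℝ → ℝ := fun t => L + vE * (c * K t + s * S t) - R t with hl
  have hlcont : Continuous l := by
    have h1 : Continuous K := intervalIntegral.continuous_primitive hCi 0
    have h2 : Continuous S := intervalIntegral.continuous_primitive hSi 0
    have h3 : Continuous R := intervalIntegral.continuous_primitive hρi 0
    fun_prop
  have hl0 : l 0 = L := by simp [hl, hK, hS, hR]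
  -- The gap closes at rate at least `v - vE`, so it vanishes by time `L / (v - vE)`.
  have hlle : ∀ t, 0 ≤ t → l t ≤ L - (v - vE) * t := fun t ht => by
    have hmono : (∫ τ in (0 : ℝ)..t, (vE * c * Real.cos (φ τ) + vE * s * Real.sin (φ τ)
        + (v - vE))) ≤ ∫ τ in (0 : ℝ)..t, ρ (φ τ) := by
      refine intervalIntegral.integral_mono_on ht
        ((((hCi 0 t).const_mul _).add ((hSi 0 t).const_mul _)).add intervalIntegrable_const)
        (hρi 0 t) fun τ _ => ?_
      have hk1 : κ (φ τ) ≤ 1 := by nlinarith [hκσ (φ τ), sq_nonneg (σ (φ τ))]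
      have : vE * κ (φ τ) + (v - vE) ≤ ρ (φ τ) := by
        refine abs_le_of_sq_le_sq' ?_ (hρ0 _) |>.2
        rw [hρ2]
        have h1 := mul_nonneg (mul_nonneg (sub_nonneg.2 hv.le) hvE.le) (sub_nonneg.2 hk1)
        have h2 : σ (φ τ) ^ 2 = 1 - κ (φ τ) ^ 2 := by linarith [hκσ (φ τ)]
        rw [h2]
        nlinarith
      rw [hκ] at this
      linarith
    rw [intervalIntegral.integral_add (((hCi 0 t).const_mul _).add ((hSi 0 t).const_mul _))
      intervalIntegrable_const, intervalIntegral.integral_add ((hCi 0 t).const_mul _)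
      ((hSi 0 t).const_mul _)] at hmono
    simp only [intervalIntegral.integral_const_mul, intervalIntegral.integral_const,
      smul_eq_mul, sub_zero] at hmono
    simp only [hl, hK, hS, hR]
    linarith
  have hM : l (L / (v - vE)) ≤ 0 := by
    have h1 : 0 < v - vE := sub_pos.2 hv
    refine (hlle _ (by positivity)).trans ?_
    rw [mul_div_cancel₀ _ h1.ne', sub_self]
  have hMpos : 0 ≤ L / (v - vE) := div_nonneg hL.le (sub_pos.2 hv).le
  have hcomp : IsCompact (Set.Icc 0 (L / (v - vE)) ∩ {t | l t ≤ 0}) :=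
    isCompact_Icc.inter_right (isClosed_le hlcont continuous_const)
  obtain ⟨T, ⟨hTmem, hTle⟩, hTleast⟩ := hcomp.exists_isLeast ⟨_, ⟨hMpos, le_rfl⟩, hM⟩
  have hlpos : ∀ t ∈ Set.Ico 0 T, 0 ≤ l t := fun t ht => by
    by_contra! hneg
    exact absurd (hTleast ⟨⟨ht.1, ht.2.le.trans hTmem.2⟩, hneg.le⟩) (not_le.2 ht.2)
  have hlT : l T = 0 := by
    obtain ⟨T', hT', hT'0⟩ := intermediate_value_Icc' hTmem.1 hlcont.continuousOn
      (show (0 : ℝ) ∈ Set.Icc (l T) (l 0) from ⟨hTle, hl0 ▸ hL.le⟩)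
    have := hTleast ⟨⟨hT'.1, hT'.2.trans hTmem.2⟩, hT'0.le⟩
    rwa [le_antisymm this hT'.2]
  refine ⟨T, hTmem.1, ?_, fun t ht => ?_⟩
  · have e : L + vE * (c * K T + s * S T) - R T = 0 := hlT
    ext i
    fin_cases i
    · simp only [Fin.zero_eta, trajectory_zero, hcosη]
      change _ = X 0 + vE * K T
      linear_combination (-c) * e - hc' + vE * K T * hcs
    · simp only [Fin.mk_one, trajectory_one, hsinη]
      change _ = X 1 + vE * S T
      linear_combination (-s) * e - hs' + vE * S T * hcs
  · have hlt : 0 ≤ L + vE * (c * K t + s * S t) - R t := hlpos t ht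
    have hKS : K t ^ 2 + S t ^ 2 ≤ t ^ 2 := hφ.sq_integral_le ht.1
    have hR0 : 0 ≤ R t := intervalIntegral.integral_nonneg ht.1 fun τ _ => hρ0 _
    -- Pointwise `ρ² = (v² - vE²) + (vE κ)²`; the planar triangle inequality integrates this. Before
    -- capture `R` is at most `L` plus the evader's longitudinal displacement, so the bound passes
    -- to the evader's distance from `P`.
    have hRt : (v ^ 2 - vE ^ 2) * t ^ 2 + (vE * (c * K t + s * S t)) ^ 2 ≤ R t ^ 2 := by
      have hw : √(v ^ 2 - vE ^ 2) ^ 2 = v ^ 2 - vE ^ 2 := Real.sq_sqrt (by nlinarith)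
      have := sq_integral_add_sq_integral_le ht.1
        (intervalIntegrable_const (c := √(v ^ 2 - vE ^ 2)))
        (((hCi 0 t).const_mul (vE * c)).add ((hSi 0 t).const_mul (vE * s))) (hρi 0 t)
        (fun τ => hρ0 _) (fun τ => by
          have h1 := hκσ (φ τ)
          rw [hρ2, hw]
          have h2 : vE * c * Real.cos (φ τ) + vE * s * Real.sin (φ τ) = vE * κ (φ τ) := by
            rw [hκ]; ring
          rw [h2]
          apply le_of_eq
          linear_combination vE ^ 2 * h1)
      rw [intervalIntegral.integral_add ((hCi 0 t).const_mul _) ((hSi 0 t).const_mul _)] at this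
      simp only [intervalIntegral.integral_const_mul, intervalIntegral.integral_const,
        smul_eq_mul, sub_zero, mul_pow, hw] at this
      calc _ = t ^ 2 * (v ^ 2 - vE ^ 2) + (vE * c * K t + vE * s * S t) ^ 2 := by ring
        _ ≤ _ := this
    refine abs_le_of_sq_le_sq' ?_ (mul_nonneg hvE.le dist_nonneg) |>.2
    rw [mul_pow, mul_pow, dist_sq_eq, dist_sq_eq]
    simp only [trajectory_zero, trajectory_one]
    change v ^ 2 * ((X 0 - (X 0 + vE * K t)) ^ 2 + (X 1 - (X 1 + vE * S t)) ^ 2) ≤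
      vE ^ 2 * ((P 0 - (X 0 + vE * K t)) ^ 2 + (P 1 - (X 1 + vE * S t)) ^ 2)
    have hP0 : P 0 = X 0 - L * c := by linarith
    have hP1 : P 1 = X 1 - L * s := by linarith
    have hPd : (P 0 - (X 0 + vE * K t)) ^ 2 + (P 1 - (X 1 + vE * S t)) ^ 2
        = (L + vE * (c * K t + s * S t)) ^ 2 + (vE * (c * S t - s * K t)) ^ 2 := by
      rw [hP0, hP1]
      linear_combination (L ^ 2 - vE ^ 2 * (K t ^ 2 + S t ^ 2)) * hcs
    have hab : (vE * (c * K t + s * S t)) ^ 2 + (vE * (c * S t - s * K t)) ^ 2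
        = vE ^ 2 * (K t ^ 2 + S t ^ 2) := by
      linear_combination vE ^ 2 * (K t ^ 2 + S t ^ 2) * hcs
    have hsq : R t ^ 2 ≤ (L + vE * (c * K t + s * S t)) ^ 2 :=
      pow_le_pow_left₀ hR0 (by linarith) 2
    have hw0 : 0 ≤ v ^ 2 - vE ^ 2 := by nlinarith
    have h1 := mul_le_mul_of_nonneg_left hKS hw0
    rw [hPd]
    calc _ = vE ^ 2 * ((v ^ 2 - vE ^ 2) * (K t ^ 2 + S t ^ 2) + vE ^ 2 * (K t ^ 2 + S t ^ 2)) := by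
          ring
      _ ≤ _ := mul_le_mul_of_nonneg_left
        (by linear_combination h1 + hRt + hsq - hab) (sq_nonneg vE)

/-! ### The goal line and the playing region -/

theorem goal_eq_image (xbar : ℝ) : goal xbar = (fun g : ℝ => (!₂[g, 0] : Plane)) '' Set.Icc 0 xbar := by
  ext Z
  constructor
  · rintro ⟨⟨h0, h1, -⟩, h2⟩
    refine ⟨Z 0, ⟨h0, h1⟩, ?_⟩
    ext i
    fin_cases i
    · rfl
    · exact h2.symm
  · rintro ⟨g, hg, rfl⟩
    exact ⟨⟨hg.1, hg.2, le_rfl⟩, rfl⟩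

theorem isCompact_goal (xbar : ℝ) : IsCompact (goal xbar) := by
  rw [goal_eq_image]
  refine isCompact_Icc.image ?_
  refine (PiLp.continuous_toLp 2 _).comp (continuous_pi fun i => ?_)
  fin_cases i
  · exact continuous_id
  · exact continuous_const

theorem isClosed_field (xbar : ℝ) : IsClosed (field xbar) := by
  have h : ∀ i : Fin 2, Continuous fun X : Plane => X i := fun i => PiLp.continuous_apply 2 _ i
  exact (isClosed_le continuous_const (h 0)).inter
    ((isClosed_le (h 0) continuous_const).inter (isClosed_le continuous_const (h 1)))

theorem isClosed_playStates (xbar : ℝ) : IsClosed (playStates xbar) :=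
  ((isClosed_field xbar).preimage continuous_fst).inter
    (((isClosed_field xbar).preimage (continuous_fst.comp continuous_snd)).inter
      ((isClosed_field xbar).preimage (continuous_snd.comp continuous_snd)))

theorem convex_field (xbar : ℝ) : Convex ℝ (field xbar) := by
  rintro X ⟨hX0, hX1, hX2⟩ Y ⟨hY0, hY1, hY2⟩ a b ha hb hab
  simp only [field, Set.mem_ofPred_eq, PiLp.add_apply, PiLp.smul_apply, smul_eq_mul]
  refine ⟨by positivity, ?_, by positivity⟩
  calc a * X 0 + b * Y 0 ≤ a * xbar + b * xbar := by gcongr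
    _ = xbar := by rw [← add_mul, hab, one_mul]

/-! ### Winning strategies of the two sides -/

theorem disjoint_evaderRegion_pursuerRegion (vE v₁ v₂ xbar : ℝ) :
    Disjoint (evaderRegion vE v₁ v₂ xbar) (pursuerRegion vE v₁ v₂ xbar) := by
  rw [Set.disjoint_left]
  rintro s ⟨-, φ, hφ, he⟩ ⟨-, β, hβ, hp⟩
  obtain ⟨h₁, h₂⟩ := hβ.1 φ hφ
  obtain ⟨T, hT, hTgoal, hTcap⟩ := he _ _ h₁ h₂
  obtain ⟨T', hT', hcap, hgoal⟩ := hp φ hφ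
  rcases le_or_gt T' T with h | h
  · exact (hTcap T' ⟨hT', h⟩).2 hcap
  · exact hgoal T ⟨hT, h⟩ hTgoal

/-- If the evader can reach a point of the goal line strictly earlier than both pursuers, then it
wins by running straight to it. -/
theorem mem_evaderRegion {vE v₁ v₂ xbar : ℝ} (hvE : 0 < vE) (hv₁ : vE < v₁) (hv₂ : vE < v₂)
    {s : State} (hs : s ∈ playStates xbar) {Z : Plane} (hZ : Z ∈ goal xbar)
    (h₁ : v₁ * dist s.1 Z < vE * dist s.2.1 Z) (h₂ : v₂ * dist s.1 Z < vE * dist s.2.2 Z) :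
    s ∈ evaderRegion vE v₁ v₂ xbar := by
  refine ⟨hs, ?_⟩
  set X := s.1 with hX
  set D := dist X Z with hD
  have hD0 : 0 ≤ D := dist_nonneg
  obtain ⟨θ, hθ, hc, hsn⟩ : ∃ θ ∈ Set.Icc (-Real.pi) Real.pi,
      D * Real.cos θ = Z 0 - X 0 ∧ D * Real.sin θ = Z 1 - X 1 := by
    have hD2 : D ^ 2 = (X 0 - Z 0) ^ 2 + (X 1 - Z 1) ^ 2 := dist_sq_eq X Z
    have hn : ‖(⟨Z 0 - X 0, Z 1 - X 1⟩ : ℂ)‖ = D := by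
      rw [← sq_eq_sq₀ (norm_nonneg _) hD0, ← Complex.normSq_eq_norm_sq, Complex.normSq_mk, hD2]
      ring
    refine ⟨Complex.arg ⟨Z 0 - X 0, Z 1 - X 1⟩,
      ⟨(Complex.neg_pi_lt_arg _).le, Complex.arg_le_pi _⟩, ?_, ?_⟩
    · rw [← hn, Complex.norm_mul_cos_arg]
    · rw [← hn, Complex.norm_mul_sin_arg]
  refine ⟨fun _ => θ, ⟨measurable_const, fun _ => hθ⟩, fun ψ₁ ψ₂ hψ₁ hψ₂ => ?_⟩
  have htraj : ∀ t, trajectory vE X (fun _ => θ) t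
      = !₂[X 0 + vE * t * Real.cos θ, X 1 + vE * t * Real.sin θ] := fun t => by
    simp [trajectory, mul_assoc]
  have hline : ∀ t ∈ Set.Icc 0 (D / vE), ∃ r ∈ Set.Icc (0 : ℝ) 1, vE * t = r * D ∧
      trajectory vE X (fun _ => θ) t = (1 - r) • X + r • Z := fun t ht => by
    have htD : vE * t ≤ D := by
      rw [mul_comm]; exact (le_div_iff₀ hvE).1 ht.2
    obtain ⟨r, hr, hrt⟩ : ∃ r ∈ Set.Icc (0 : ℝ) 1, vE * t = r * D := by
      rcases hD0.eq_or_lt with h0 | h0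
      · refine ⟨0, ⟨le_rfl, zero_le_one⟩, ?_⟩
        have := mul_nonneg hvE.le ht.1
        linarith
      · exact ⟨vE * t / D, ⟨div_nonneg (mul_nonneg hvE.le ht.1) hD0, (div_le_one h0).2 htD⟩,
          by field_simp⟩
    refine ⟨r, hr, hrt, ?_⟩
    rw [htraj, hrt]
    ext i
    fin_cases i
    · change X 0 + r * D * Real.cos θ = (1 - r) * X 0 + r * Z 0
      linear_combination r * hc
    · change X 1 + r * D * Real.sin θ = (1 - r) * X 1 + r * Z 1
      linear_combination r * hsn
  have hT0 : 0 ≤ D / vE := div_nonneg hD0 hvE.le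
  have hrest : ∀ t ∈ Set.Icc 0 (D / vE), dist (trajectory vE X (fun _ => θ) t) Z = D - vE * t :=
    fun t ht => by
      obtain ⟨r, hr, hrt, he⟩ := hline t ht
      have : (1 - r) • X + r • Z = AffineMap.lineMap X Z r := by
        rw [AffineMap.lineMap_apply_module]
      rw [he, this, dist_lineMap_right, Real.norm_of_nonneg (sub_nonneg.2 hr.2), hrt, ← hD]
      ring
  -- A pursuer that met the evader at time `t` could follow the rest of its segment, so `dist P Z ≤
  -- v * t + (D - vE * t)`. With `vE * t ≤ D` and `vE < v` this contradicts its late arrival at `Z`.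
  have hesc : ∀ {v : ℝ} {P : Plane} {ψ : ℝ → ℝ}, vE < v → IsHeading ψ →
      v * D < vE * dist P Z → ∀ t ∈ Set.Icc 0 (D / vE),
      trajectory v P ψ t ≠ trajectory vE X (fun _ => θ) t := fun {v P ψ} hv hψ hlt t ht heq => by
    have h1 := dist_trajectory_le (hvE.trans hv).le P hψ ht.1
    have h2 := dist_triangle P (trajectory v P ψ t) Z
    rw [dist_comm P (trajectory v P ψ t), heq, hrest t ht] at h2
    rw [heq] at h1
    have htD : vE * t ≤ D := by
      rw [mul_comm]; exact (le_div_iff₀ hvE).1 ht.2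
    nlinarith [mul_le_mul_of_nonneg_left htD (sub_nonneg.2 hv.le),
      mul_le_mul_of_nonneg_left (h2.trans (add_le_add_left h1 _)) hvE.le]
  refine ⟨D / vE, hT0, ?_, fun t ht => ⟨?_, ?_⟩⟩
  · have h0 := hrest _ ⟨hT0, le_rfl⟩
    rw [mul_div_cancel₀ _ hvE.ne', sub_self, dist_eq_zero] at h0
    rwa [h0]
  · obtain ⟨r, hr, -, he⟩ := hline t ht
    rw [he]
    exact convex_field xbar hs.1 hZ.1 (sub_nonneg.2 hr.2) hr.1 (by ring)
  · rintro (h | h)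
    · exact hesc hv₁ hψ₁ h₁ t ht h
    · exact hesc hv₂ hψ₂ h₂ t ht h

/-- If every point of the goal line can be reached by one of the pursuers strictly earlier than by
the evader, then parallel pursuit by both pursuers wins. -/
theorem mem_pursuerRegion {vE v₁ v₂ xbar : ℝ} (hvE : 0 < vE) (hv₁ : vE < v₁) (hv₂ : vE < v₂)
    {s : State} (hs : s ∈ playStates xbar)
    (h : ∀ Z ∈ goal xbar,
      vE * dist s.2.1 Z < v₁ * dist s.1 Z ∨ vE * dist s.2.2 Z < v₂ * dist s.1 Z) :
    s ∈ pursuerRegion vE v₁ v₂ xbar := by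
  obtain ⟨η₁, hm₁, hI₁, hη₁⟩ := exists_parallel_pursuit hvE hv₁ s.1 s.2.1
  obtain ⟨η₂, hm₂, hI₂, hη₂⟩ := exists_parallel_pursuit hvE hv₂ s.1 s.2.2
  refine ⟨hs, fun φ => (fun t => η₁ (φ t), fun t => η₂ (φ t)), ⟨fun φ hφ =>
    ⟨⟨hm₁.comp hφ.1, fun _ => hI₁ _⟩, ⟨hm₂.comp hφ.1, fun _ => hI₂ _⟩⟩,
    fun φ φ' _ _ t _ hae => ?_⟩, fun φ hφ => ?_⟩
  -- The answer at each instant depends only on the evader's heading at that instant.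
  · filter_upwards [hae] with u hu
    simp only [hu, and_self]
  · obtain ⟨T₁, hT₁, hc₁, hd₁⟩ := hη₁ φ hφ
    obtain ⟨T₂, hT₂, hc₂, hd₂⟩ := hη₂ φ hφ
    refine ⟨min T₁ T₂, le_min hT₁ hT₂, ?_, fun t ht hg => ?_⟩
    · rcases min_choice T₁ T₂ with e | e
      · exact Or.inl (by rw [e]; exact hc₁)
      · exact Or.inr (by rw [e]; exact hc₂)
    -- A goal point reached before capture lies in both Apollonius discs, whereas the hypothesis
    -- excludes it from one of them.
    · rcases h _ hg with hlt | hlt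
      · exact absurd (hd₁ t ⟨ht.1, ht.2.trans_le (min_le_left _ _)⟩) (not_le.2 hlt)
      · exact absurd (hd₂ t ⟨ht.1, ht.2.trans_le (min_le_right _ _)⟩) (not_le.2 hlt)

/-! ### The barrier in terms of arrival times -/

/-- Moving a point of the upper half plane upwards. -/
def lift (ε : ℝ) (X : Plane) : Plane := !₂[X 0, X 1 + ε]

theorem lift_mem_field {xbar ε : ℝ} (hε : 0 ≤ ε) {X : Plane} (hX : X ∈ field xbar) :
    lift ε X ∈ field xbar :=
  ⟨hX.1, hX.2.1, add_nonneg hX.2.2 hε⟩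

/-- Lifting a player delays its arrival at all goal points at once; this makes the weak inequalities
of a barrier state strict. -/
theorem dist_lt_dist_lift {xbar ε : ℝ} (hε : 0 < ε) {X Z : Plane} (hX : X ∈ field xbar)
    (hZ : Z ∈ goal xbar) : dist X Z < dist (lift ε X) Z := by
  refine lt_of_pow_lt_pow_left₀ 2 dist_nonneg ?_
  rw [dist_sq_eq, dist_sq_eq, hZ.2]
  change (X 0 - Z 0) ^ 2 + (X 1 - 0) ^ 2 < (X 0 - Z 0) ^ 2 + (X 1 + ε - 0) ^ 2
  nlinarith [hX.2.2]

theorem continuous_lift (X : Plane) : Continuous fun ε => lift ε X := by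
  refine (PiLp.continuous_toLp 2 _).comp (continuous_pi fun i => ?_)
  fin_cases i
  · exact continuous_const
  · exact continuous_const.add continuous_id

theorem lift_zero (X : Plane) : lift 0 X = X := by
  ext i
  fin_cases i
  · rfl
  · exact add_zero _

theorem mem_closure_of_forall_pos {Y : Type*} [TopologicalSpace Y] {f : ℝ → Y} (hf : Continuous f)
    {S : Set Y} (h : ∀ ε, 0 < ε → f ε ∈ S) : f 0 ∈ closure S := by
  refine mem_closure_of_tendsto ((hf.tendsto 0).mono_left (nhdsWithin_le_nhds (s := Set.Ioi 0))) ?_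
  filter_upwards [self_mem_nhdsWithin] with ε hε using h ε hε

/-- The Barrier surface consists of the states for which every point of the goal line is reached
by a pursuer no later than by the evader, but one of them not strictly earlier. -/
theorem mem_barrier_iff {vE v₁ v₂ xbar : ℝ} (hvE : 0 < vE) (hv₁ : vE < v₁) (hv₂ : vE < v₂)
    (s : State) :
    s ∈ barrier vE v₁ v₂ xbar ↔ s ∈ playStates xbar ∧
      (∀ Z ∈ goal xbar,
        vE * dist s.2.1 Z ≤ v₁ * dist s.1 Z ∨ vE * dist s.2.2 Z ≤ v₂ * dist s.1 Z) ∧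
      ∃ Z ∈ goal xbar,
        v₁ * dist s.1 Z ≤ vE * dist s.2.1 Z ∧ v₂ * dist s.1 Z ≤ vE * dist s.2.2 Z := by
  have hv₁0 := hvE.trans hv₁
  have hv₂0 := hvE.trans hv₂
  constructor
  · rintro ⟨he, hp⟩
    refine ⟨closure_minimal (fun _ h => h.1) (isClosed_playStates xbar) he, fun Z hZ => ?_, ?_⟩
    · have hcl : IsClosed {s : State | vE * dist s.2.1 Z ≤ v₁ * dist s.1 Z ∨
          vE * dist s.2.2 Z ≤ v₂ * dist s.1 Z} := by
        rw [Set.ofPred_or]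
        exact (isClosed_le (by fun_prop) (by fun_prop)).union
          (isClosed_le (by fun_prop) (by fun_prop))
      refine closure_minimal (fun s' hs' => ?_) hcl hp
      by_contra hcon
      rw [Set.mem_ofPred_eq, not_or, not_le, not_le] at hcon
      exact Set.disjoint_left.1 (disjoint_evaderRegion_pursuerRegion vE v₁ v₂ xbar)
        (mem_evaderRegion hvE hv₁ hv₂ hs'.1 hZ hcon.1 hcon.2) hs'
    -- The existential over `Z` is a projection along the compact goal line, hence a closed map.
    · have hcl : IsClosed {s : State | ∃ Z ∈ goal xbar,
          v₁ * dist s.1 Z ≤ vE * dist s.2.1 Z ∧ v₂ * dist s.1 Z ≤ vE * dist s.2.2 Z} := by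
        have : CompactSpace (goal xbar) := isCompact_iff_compactSpace.1 (isCompact_goal xbar)
        have hc : IsClosed {q : State × goal xbar |
            v₁ * dist q.1.1 q.2 ≤ vE * dist q.1.2.1 q.2 ∧
              v₂ * dist q.1.1 q.2 ≤ vE * dist q.1.2.2 q.2} := by
          rw [Set.ofPred_and]
          exact (isClosed_le (by fun_prop) (by fun_prop)).inter
            (isClosed_le (by fun_prop) (by fun_prop))
        convert isClosedMap_fst_of_compactSpace _ hc using 1
        ext s'
        constructor
        · rintro ⟨Z, hZ, h⟩
          exact ⟨(s', ⟨Z, hZ⟩), h, rfl⟩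
        · rintro ⟨⟨s'', Z, hZ⟩, h, rfl⟩
          exact ⟨Z, hZ, h⟩
      refine closure_minimal (fun s' hs' => ?_) hcl he
      by_contra hcon
      refine Set.disjoint_left.1 (disjoint_evaderRegion_pursuerRegion vE v₁ v₂ xbar) hs'
        (mem_pursuerRegion hvE hv₁ hv₂ hs'.1 fun Z hZ => ?_)
      by_contra! hZ'
      exact hcon ⟨Z, hZ, hZ'⟩
  · obtain ⟨X, P₁, P₂⟩ := s
    rintro ⟨⟨hX, hP₁, hP₂⟩, hall, Z, hZ, h₁, h₂⟩
    dsimp only at hX hP₁ hP₂ hall h₁ h₂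
    constructor
    -- Slightly lifted pursuers are too late at `Z`, so the evader wins.
    · have := mem_closure_of_forall_pos
        (f := fun ε => ((X, lift ε P₁, lift ε P₂) : State)) (S := evaderRegion vE v₁ v₂ xbar)
        (continuous_const.prodMk ((continuous_lift P₁).prodMk (continuous_lift P₂)))
        fun ε hε => mem_evaderRegion hvE hv₁ hv₂
          ⟨hX, lift_mem_field hε.le hP₁, lift_mem_field hε.le hP₂⟩ hZ
          (h₁.trans_lt (mul_lt_mul_of_pos_left (dist_lt_dist_lift hε hP₁ hZ) hvE))
          (h₂.trans_lt (mul_lt_mul_of_pos_left (dist_lt_dist_lift hε hP₂ hZ) hvE))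
      simpa only [lift_zero] using this
    -- A slightly lifted evader is too late at every goal point, so the pursuers win.
    · have := mem_closure_of_forall_pos
        (f := fun ε => ((lift ε X, P₁, P₂) : State)) (S := pursuerRegion vE v₁ v₂ xbar)
        ((continuous_lift X).prodMk continuous_const)
        fun ε hε => mem_pursuerRegion hvE hv₁ hv₂
          ⟨lift_mem_field hε.le hX, hP₁, hP₂⟩ fun W hW => (hall W hW).imp
          (fun h => h.trans_lt (mul_lt_mul_of_pos_left (dist_lt_dist_lift hε hX hW) hv₁0))
          (fun h => h.trans_lt (mul_lt_mul_of_pos_left (dist_lt_dist_lift hε hX hW) hv₂0))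
      simpa only [lift_zero] using this

/-! ### The margin parabolas on the goal line -/

/-- The difference of the squares of the two sides of the equation of the Apollonius circle, at the
point `(g, 0)`: it is positive where the evader is faster. -/
def margin (γ : ℝ) (P X : Plane) (g : ℝ) : ℝ :=
  γ ^ 2 * ((P 0 - g) ^ 2 + P 1 ^ 2) - ((X 0 - g) ^ 2 + X 1 ^ 2)

/-- The left hand side of the equation of the tangency curve. -/
def tangency (γ : ℝ) (P X : Plane) : ℝ :=
  γ ^ 2 * X 0 ^ 2 - (1 - γ ^ 2) * X 1 ^ 2 - 2 * γ ^ 2 * P 0 * X 0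
    + γ ^ 2 * (P 0 ^ 2 + (1 - γ ^ 2) * P 1 ^ 2)

/-- Completing the square: for `γ ^ 2 < 1` the vertex is at `(X 0 - γ ^ 2 * P 0) / (1 - γ ^ 2)` and
`tangency` is the vertex value up to a positive factor. -/
theorem margin_mul (γ : ℝ) (P X : Plane) (g : ℝ) :
    (1 - γ ^ 2) * margin γ P X g
      = tangency γ P X - ((1 - γ ^ 2) * g - (X 0 - γ ^ 2 * P 0)) ^ 2 := by
  unfold margin tangency
  ring

theorem mem_tangencyCurve {γ : ℝ} {P X : Plane} : X ∈ tangencyCurve γ P ↔ tangency γ P X = 0 :=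
  Iff.rfl

theorem mem_goalCircle {γ c : ℝ} {P X : Plane} :
    X ∈ goalCircle γ c P ↔ margin γ P X c = 0 := by
  unfold margin
  change (X 0 - c) ^ 2 + X 1 ^ 2 = γ ^ 2 * ((P 0 - c) ^ 2 + P 1 ^ 2) ↔ _
  rw [sub_eq_zero, eq_comm]

theorem dist_axis_sq (P : Plane) (g : ℝ) : dist P !₂[g, 0] ^ 2 = (P 0 - g) ^ 2 + P 1 ^ 2 := by
  rw [dist_sq_eq]
  change (P 0 - g) ^ 2 + (P 1 - 0) ^ 2 = _
  rw [sub_zero]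

theorem sq_mul_margin {vE v : ℝ} (hv : 0 < v) (P X : Plane) (g : ℝ) :
    v ^ 2 * margin (vE / v) P X g = (vE * dist P !₂[g, 0]) ^ 2 - (v * dist X !₂[g, 0]) ^ 2 := by
  rw [mul_pow, mul_pow, dist_axis_sq, dist_axis_sq]
  unfold margin
  field_simp

theorem margin_nonneg_iff {vE v : ℝ} (hvE : 0 < vE) (hv : 0 < v) (P X : Plane) (g : ℝ) :
    0 ≤ margin (vE / v) P X g ↔ v * dist X !₂[g, 0] ≤ vE * dist P !₂[g, 0] := by
  rw [← mul_nonneg_iff_of_pos_left (pow_pos hv 2), sq_mul_margin hv, sub_nonneg,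
    sq_le_sq₀ (by positivity) (by positivity)]

theorem margin_nonpos_iff {vE v : ℝ} (hvE : 0 < vE) (hv : 0 < v) (P X : Plane) (g : ℝ) :
    margin (vE / v) P X g ≤ 0 ↔ vE * dist P !₂[g, 0] ≤ v * dist X !₂[g, 0] := by
  rw [← mul_le_mul_iff_right₀ (pow_pos hv 2), mul_zero, sq_mul_margin hv, sub_nonpos,
    sq_le_sq₀ (by positivity) (by positivity)]

/-- `ha` places the vertex at or to the left of `a`, so the concave parabola decreases beyond `a`.
-/
theorem margin_le_of_right {γ : ℝ} (hγ : γ ^ 2 < 1) {P X : Plane} {a g : ℝ} (hag : a ≤ g)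
    (ha : X 0 ≤ (1 - γ ^ 2) * a + γ ^ 2 * P 0) : margin γ P X g ≤ margin γ P X a := by
  have h1 : margin γ P X a - margin γ P X g
      = (g - a) * ((1 - γ ^ 2) * (g - a) + 2 * ((1 - γ ^ 2) * a + γ ^ 2 * P 0 - X 0)) := by
    unfold margin; ring
  have h2 : 0 ≤ (1 - γ ^ 2) * (g - a) := mul_nonneg (by linarith) (by linarith)
  have h3 := mul_nonneg (sub_nonneg.2 hag) (by linarith :
    0 ≤ (1 - γ ^ 2) * (g - a) + 2 * ((1 - γ ^ 2) * a + γ ^ 2 * P 0 - X 0))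
  linarith

theorem margin_le_of_left {γ : ℝ} (hγ : γ ^ 2 < 1) {P X : Plane} {a g : ℝ} (hag : g ≤ a)
    (ha : (1 - γ ^ 2) * a + γ ^ 2 * P 0 ≤ X 0) : margin γ P X g ≤ margin γ P X a := by
  have h1 : margin γ P X a - margin γ P X g
      = (a - g) * ((1 - γ ^ 2) * (a - g) + 2 * (X 0 - ((1 - γ ^ 2) * a + γ ^ 2 * P 0))) := by
    unfold margin; ring
  have h2 : 0 ≤ (1 - γ ^ 2) * (a - g) := mul_nonneg (by linarith) (by linarith)
  have h3 := mul_nonneg (sub_nonneg.2 hag) (by linarith :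
    0 ≤ (1 - γ ^ 2) * (a - g) + 2 * (X 0 - ((1 - γ ^ 2) * a + γ ^ 2 * P 0)))
  linarith

theorem margin_le_vertex {γ : ℝ} (hγ : γ ^ 2 < 1) (P X : Plane) (g : ℝ) :
    margin γ P X g ≤ tangency γ P X / (1 - γ ^ 2) := by
  rw [le_div_iff₀ (by linarith), mul_comm, margin_mul]
  exact sub_le_self _ (sq_nonneg _)

theorem margin_vertex {γ : ℝ} (hγ : γ ^ 2 < 1) (P X : Plane) :
    margin γ P X ((X 0 - γ ^ 2 * P 0) / (1 - γ ^ 2)) = tangency γ P X / (1 - γ ^ 2) := by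
  have h : 1 - γ ^ 2 ≠ 0 := by linarith
  rw [eq_div_iff h, mul_comm, margin_mul, mul_div_cancel₀ _ h, sub_self]
  ring

/-- The maximum `k` of `min F₁ F₂` vanishes iff `min F₁ F₂ ≤ 0` everywhere and `0 ≤ min F₁ F₂`
somewhere, for functions that cross at `c`. -/
theorem forall_exists_iff_max_eq_zero {F₁ F₂ : ℝ → ℝ} {a b c k : ℝ} (hac : a ≤ c) (hcb : c ≤ b)
    (h₁ : ∀ g ∈ Set.Icc a c, F₁ g ≤ F₂ g) (h₂ : ∀ g ∈ Set.Icc c b, F₂ g ≤ F₁ g)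
    (k₁ : ∀ g ∈ Set.Icc a c, F₁ g ≤ k) (k₂ : ∀ g ∈ Set.Icc c b, F₂ g ≤ k)
    (hk : (∃ g ∈ Set.Icc a c, F₁ g = k) ∨ ∃ g ∈ Set.Icc c b, F₂ g = k) :
    ((∀ g ∈ Set.Icc a b, F₁ g ≤ 0 ∨ F₂ g ≤ 0) ∧ ∃ g ∈ Set.Icc a b, 0 ≤ F₁ g ∧ 0 ≤ F₂ g)
      ↔ k = 0 := by
  constructor
  · rintro ⟨hall, g, hg, hg₁, hg₂⟩
    apply le_antisymm
    · rcases hk with ⟨x, hx, rfl⟩ | ⟨x, hx, rfl⟩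
      · rcases hall x ⟨hx.1, hx.2.trans hcb⟩ with h | h
        · exact h
        · exact (h₁ x hx).trans h
      · rcases hall x ⟨hac.trans hx.1, hx.2⟩ with h | h
        · exact (h₂ x hx).trans h
        · exact h
    · rcases le_total g c with h | h
      · exact hg₁.trans (k₁ g ⟨hg.1, h⟩)
      · exact hg₂.trans (k₂ g ⟨h, hg.2⟩)
  · rintro rfl
    refine ⟨fun g hg => ?_, ?_⟩
    · rcases le_total g c with h | h
      · exact Or.inl (k₁ g ⟨hg.1, h⟩)
      · exact Or.inr (k₂ g ⟨h, hg.2⟩)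
    · rcases hk with ⟨x, hx, h⟩ | ⟨x, hx, h⟩
      · exact ⟨x, ⟨hx.1, hx.2.trans hcb⟩, h.ge, h ▸ h₁ x hx⟩
      · exact ⟨x, ⟨hac.trans hx.1, hx.2⟩, h ▸ h₂ x hx, h.ge⟩

theorem iff_piecewise {x t₀ t₁ t₂ t₃ : ℝ} {Q A B C D E : Prop} (h₀₁ : t₀ ≤ t₁) (h₁₂ : t₁ ≤ t₂)
    (h₂₃ : t₂ ≤ t₃) (hA : x ≤ t₀ → (Q ↔ A)) (hB : t₀ < x → x ≤ t₁ → (Q ↔ B))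
    (hC : t₁ < x → x ≤ t₂ → (Q ↔ C)) (hD : t₂ < x → x ≤ t₃ → (Q ↔ D)) (hE : t₃ < x → (Q ↔ E)) :
    Q ↔ (x ≤ t₀ ∧ A) ∨ (t₀ < x ∧ x ≤ t₁ ∧ B) ∨ (t₁ < x ∧ x ≤ t₂ ∧ C) ∨ (t₂ < x ∧ x ≤ t₃ ∧ D) ∨
      (t₃ < x ∧ E) := by
  grind

/-- Which of two pursuers, with speed ratio `γ < 1`, is earlier at the points of the goal line. -/
theorem xI_spec {γ xbar : ℝ} (hγ : γ ^ 2 < 1) (hxbar : 0 < xbar) {P₁ P₂ : Plane}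
    (hleft : (P₁ 0 - 0) ^ 2 + P₁ 1 ^ 2 ≤ γ ^ 2 * ((P₂ 0 - 0) ^ 2 + P₂ 1 ^ 2))
    (hright : γ ^ 2 * ((P₂ 0 - xbar) ^ 2 + P₂ 1 ^ 2) ≤ (P₁ 0 - xbar) ^ 2 + P₁ 1 ^ 2) :
    0 ≤ xI γ P₁ P₂ ∧ xI γ P₁ P₂ ≤ xbar ∧ P₁ 0 - γ ^ 2 * P₂ 0 ≤ (1 - γ ^ 2) * xI γ P₁ P₂ ∧
      (∀ g ∈ Set.Icc 0 (xI γ P₁ P₂),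
        (P₁ 0 - g) ^ 2 + P₁ 1 ^ 2 ≤ γ ^ 2 * ((P₂ 0 - g) ^ 2 + P₂ 1 ^ 2)) ∧
      ∀ g, xI γ P₁ P₂ ≤ g →
        γ ^ 2 * ((P₂ 0 - g) ^ 2 + P₂ 1 ^ 2) ≤ (P₁ 0 - g) ^ 2 + P₁ 1 ^ 2 := by
  have hpos : 0 < 1 - γ ^ 2 := by linarith
  obtain ⟨Δ, hΔ⟩ : ∃ Δ, Δ = γ ^ 2 * (P₁ 0 - P₂ 0) ^ 2 -
    (1 - γ ^ 2) * (P₁ 1 ^ 2 - γ ^ 2 * P₂ 1 ^ 2) := ⟨_, rfl⟩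
  obtain ⟨e, he⟩ : ∃ e, e = P₁ 0 - γ ^ 2 * P₂ 0 := ⟨_, rfl⟩
  -- The comparison of the pursuers is a convex parabola with roots `(e ± √Δ) / (1 - γ ^ 2)` when `0
  -- ≤ Δ`, and `xI` is the right one. `hleft` puts `0` between the roots, which also yields `0 ≤ Δ`;
  -- `hright` keeps `xbar` from lying strictly between them.
  have hid : ∀ g, (1 - γ ^ 2) * ((P₁ 0 - g) ^ 2 + P₁ 1 ^ 2 -
      γ ^ 2 * ((P₂ 0 - g) ^ 2 + P₂ 1 ^ 2)) = ((1 - γ ^ 2) * g - e) ^ 2 - Δ := fun g => by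
    rw [hΔ, he]; ring
  have hle : ∀ g, (P₁ 0 - g) ^ 2 + P₁ 1 ^ 2 ≤ γ ^ 2 * ((P₂ 0 - g) ^ 2 + P₂ 1 ^ 2) ↔
      ((1 - γ ^ 2) * g - e) ^ 2 ≤ Δ := fun g => by
    rw [← sub_nonpos, ← mul_le_mul_iff_right₀ hpos, hid, mul_zero, sub_nonpos]
  have hge : ∀ g, γ ^ 2 * ((P₂ 0 - g) ^ 2 + P₂ 1 ^ 2) ≤ (P₁ 0 - g) ^ 2 + P₁ 1 ^ 2 ↔
      Δ ≤ ((1 - γ ^ 2) * g - e) ^ 2 := fun g => by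
    rw [← sub_nonneg, ← mul_le_mul_iff_right₀ hpos, hid, mul_zero, sub_nonneg]
  rw [hle] at hleft
  rw [hge] at hright
  simp only [hle, hge]
  rw [mul_zero, zero_sub, neg_sq] at hleft
  obtain ⟨r, hr⟩ : ∃ r, r = √Δ := ⟨_, rfl⟩
  have hxI : (1 - γ ^ 2) * xI γ P₁ P₂ = e + r := by
    rw [xI, mul_div_cancel₀ _ hpos.ne', ← hΔ, ← he, hr]
  rw [← he, hxI]
  have hr2 : r ^ 2 = Δ := hr ▸ Real.sq_sqrt ((sq_nonneg e).trans hleft)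
  have hr0 : 0 ≤ r := hr ▸ Real.sqrt_nonneg _
  obtain ⟨he₁, he₂⟩ := abs_le.1 (Real.abs_le_sqrt hleft)
  rw [← hr] at he₁ he₂
  rw [← hr2] at hright
  rw [← hr2]
  refine ⟨?_, ?_, by linarith, fun g hg => ?_, fun g hg => ?_⟩
  · exact nonneg_of_mul_nonneg_right (by rw [hxI]; linarith) hpos
  · by_contra! hcon
    have h1 := mul_lt_mul_of_pos_left hcon hpos
    have h2 := mul_pos hpos hxbar
    exact absurd hright (not_le.2 (sq_lt_sq' (by linarith) (by linarith)))
  · have h1 := mul_le_mul_of_nonneg_left hg.2 hpos.le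
    have h2 := mul_nonneg hpos.le hg.1
    exact sq_le_sq' (by linarith) (by linarith)
  · have h1 := mul_le_mul_of_nonneg_left hg hpos.le
    exact pow_le_pow_left₀ hr0 (by linarith) 2

/-! ### Geometry of the curves -/

theorem isCircle_goalCircle {γ : ℝ} (hγ : 0 < γ) (c : ℝ) {P : Plane} (hP : 0 < P 1) :
    IsCircle (goalCircle γ c P) !₂[c, 0] := by
  have hr : 0 < γ * dist P !₂[c, 0] := by
    refine mul_pos hγ (dist_pos.2 fun h => ?_)
    rw [h] at hP
    exact lt_irrefl _ hP
  refine ⟨_, hr, Set.ext fun X => ?_⟩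
  rw [Metric.mem_sphere, ← sq_eq_sq₀ dist_nonneg hr.le, mul_pow, dist_axis_sq, dist_axis_sq]
  rfl

/-- The circles may degenerate to points. If the centers differed, comparing the ends of the
horizontal diameters would force both radii to vanish, and two distinct points would coincide. -/
theorem center_eq_of_goalCircle_eq {γ γ' c c' : ℝ} {P P' : Plane}
    (h : goalCircle γ c P = goalCircle γ' c' P') : c = c' := by
  have hmem : ∀ x y : ℝ, (x - c) ^ 2 + y ^ 2 = γ ^ 2 * ((P 0 - c) ^ 2 + P 1 ^ 2) ↔
      (x - c') ^ 2 + y ^ 2 = γ' ^ 2 * ((P' 0 - c') ^ 2 + P' 1 ^ 2) := fun x y =>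
    Set.ext_iff.1 h !₂[x, y]
  obtain ⟨r, hr⟩ : ∃ r, r ^ 2 = γ ^ 2 * ((P 0 - c) ^ 2 + P 1 ^ 2) :=
    ⟨_, Real.sq_sqrt (by positivity)⟩
  obtain ⟨r', hr'⟩ : ∃ r, r ^ 2 = γ' ^ 2 * ((P' 0 - c') ^ 2 + P' 1 ^ 2) :=
    ⟨_, Real.sq_sqrt (by positivity)⟩
  rw [← hr, ← hr'] at hmem
  have h1 := (hmem (c + r) 0).1 (by ring)
  have h2 := (hmem (c - r) 0).1 (by ring)
  have h3 := (hmem c r).1 (by ring)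
  have h4 := (hmem (c' + r') 0).2 (by ring)
  have h5 := (hmem (c' - r') 0).2 (by ring)
  by_contra hne
  have hne' : c - c' ≠ 0 := sub_ne_zero.2 hne
  have hr0 : r = 0 := by
    have : (c - c') * r = 0 := by linarith
    exact (mul_eq_zero.1 this).resolve_left hne'
  have hr0' : r' = 0 := by
    have : (c - c') * r' = 0 := by linarith
    exact (mul_eq_zero.1 this).resolve_left hne'
  rw [hr0, hr0'] at h3
  exact hne' (pow_eq_zero_iff two_ne_zero |>.1 (by linarith))

/-- The first curve has a point above every abscissa `x`. If the curves agreed, eliminating `y²`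
would give an identity of quadratics in `x`, whose leading coefficients differ because `γ' < γ`. -/
theorem tangencyCurve_ne {γ γ' : ℝ} (hγ : 0 < γ') (hγγ' : γ' < γ) (hγ1 : γ ^ 2 < 1)
    (P P' : Plane) : tangencyCurve γ P ≠ tangencyCurve γ' P' := by
  intro h
  have hsq : γ' ^ 2 < γ ^ 2 := pow_lt_pow_left₀ hγγ' hγ.le two_ne_zero
  have hpos : 0 < 1 - γ ^ 2 := by linarith
  have key : ∀ x : ℝ, (1 - γ' ^ 2) * (γ ^ 2 * ((x - P 0) ^ 2 + (1 - γ ^ 2) * P 1 ^ 2))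
      = (1 - γ ^ 2) * (γ' ^ 2 * ((x - P' 0) ^ 2 + (1 - γ' ^ 2) * P' 1 ^ 2)) := fun x => by
    obtain ⟨y, hy⟩ : ∃ y, y ^ 2 = γ ^ 2 * ((x - P 0) ^ 2 + (1 - γ ^ 2) * P 1 ^ 2) / (1 - γ ^ 2) :=
      ⟨_, Real.sq_sqrt (by positivity)⟩
    rw [eq_div_iff hpos.ne'] at hy
    have h1 : γ' ^ 2 * x ^ 2 - (1 - γ' ^ 2) * y ^ 2 - 2 * γ' ^ 2 * P' 0 * x
        + γ' ^ 2 * (P' 0 ^ 2 + (1 - γ' ^ 2) * P' 1 ^ 2) = 0 :=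
      (Set.ext_iff.1 h !₂[x, y]).1 (by
        change γ ^ 2 * x ^ 2 - (1 - γ ^ 2) * y ^ 2 - 2 * γ ^ 2 * P 0 * x
          + γ ^ 2 * (P 0 ^ 2 + (1 - γ ^ 2) * P 1 ^ 2) = 0
        linear_combination -hy)
    linear_combination (1 - γ ^ 2) * (-h1) - (1 - γ' ^ 2) * hy
  have h0 := key 0
  have h1 := key 1
  have h2 := key (-1)
  linarith

theorem isHyperbola_tangencyCurve {γ : ℝ} (hγ : 0 < γ) (hγ1 : γ < 1) {P : Plane} (hP : 0 < P 1) :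
    IsHyperbola (tangencyCurve γ P) := by
  have hγ2 : 0 < 1 - γ ^ 2 := by nlinarith
  -- The foci are the pursuer and its mirror image in the axis.
  refine ⟨!₂[P 0, P 1], !₂[P 0, -P 1], γ * P 1, mul_pos hγ hP, ?_, Set.ext fun X => ?_⟩
  · refine lt_of_pow_lt_pow_left₀ 2 dist_nonneg ?_
    rw [dist_sq_eq]
    change (2 * (γ * P 1)) ^ 2 < (P 0 - P 0) ^ 2 + (P 1 - -P 1) ^ 2
    nlinarith [mul_pos hγ2 (pow_pos hP 2)]
  · have hu : dist X !₂[P 0, P 1] ^ 2 = (X 0 - P 0) ^ 2 + (X 1 - P 1) ^ 2 := dist_sq_eq _ _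
    have hw : dist X !₂[P 0, -P 1] ^ 2 = (X 0 - P 0) ^ 2 + (X 1 - -P 1) ^ 2 := dist_sq_eq _ _
    change tangency γ P X = 0 ↔ |dist X !₂[P 0, P 1] - dist X !₂[P 0, -P 1]| = 2 * (γ * P 1)
    have hu0 : 0 ≤ dist X !₂[P 0, P 1] := dist_nonneg
    have hw0 : 0 ≤ dist X !₂[P 0, -P 1] := dist_nonneg
    generalize dist X !₂[P 0, P 1] = u at *
    generalize dist X !₂[P 0, -P 1] = w at *
    -- With `a = γ * P 1` the factors are `(u - w)² - 4a²` and `(u + w)² - 4a²`. By `hS` below, the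
    -- second can vanish on the curve only together with the first.
    have hprod : (u ^ 2 + w ^ 2 - 4 * (γ * P 1) ^ 2 - 2 * (u * w)) *
        (u ^ 2 + w ^ 2 - 4 * (γ * P 1) ^ 2 + 2 * (u * w)) = -16 * P 1 ^ 2 * tangency γ P X := by
      calc _ = (u ^ 2 + w ^ 2 - 4 * (γ * P 1) ^ 2) ^ 2 - 4 * (u ^ 2 * w ^ 2) := by ring
        _ = _ := by rw [hu, hw]; unfold tangency; ring
    rw [← sq_eq_sq₀ (abs_nonneg (u - w)) (by positivity : 0 ≤ 2 * (γ * P 1)), sq_abs]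
    constructor
    · intro ht
      have hS : 0 ≤ u ^ 2 + w ^ 2 - 4 * (γ * P 1) ^ 2 := by
        have h1 : (1 - γ ^ 2) * X 1 ^ 2
            = γ ^ 2 * (X 0 - P 0) ^ 2 + γ ^ 2 * (1 - γ ^ 2) * P 1 ^ 2 := by
          unfold tangency at ht
          linear_combination -ht
        refine nonneg_of_mul_nonneg_right (a := 1 - γ ^ 2) ?_ hγ2
        have h2 : (1 - γ ^ 2) * (u ^ 2 + w ^ 2 - 4 * (γ * P 1) ^ 2)
            = 2 * ((X 0 - P 0) ^ 2 + (1 - γ ^ 2) ^ 2 * P 1 ^ 2) := by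
          rw [hu, hw]
          linear_combination 2 * h1
        rw [h2]
        positivity
      have huw := mul_nonneg hu0 hw0
      rw [ht, mul_zero] at hprod
      rcases mul_eq_zero.1 hprod with h | h
      · linarith
      · linarith
    · intro h
      have h0 : u ^ 2 + w ^ 2 - 4 * (γ * P 1) ^ 2 - 2 * (u * w) = 0 := by linarith
      rw [h0, zero_mul] at hprod
      have : P 1 ^ 2 ≠ 0 := by positivity
      exact (mul_eq_zero.1 hprod.symm).resolve_left (by simpa using hP.ne')

theorem tangencyCurve_eq {γ : ℝ} (hγ : 0 < γ) (hγ1 : γ ^ 2 < 1) (P : Plane) :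
    tangencyCurve γ P = {X | ∃! g : ℝ, !₂[g, 0] ∈ apolloniusCircle γ P X} := by
  ext X
  have hpos : 0 < 1 - γ ^ 2 := by linarith
  have hmem : ∀ g : ℝ, !₂[g, 0] ∈ apolloniusCircle γ P X ↔
      ((1 - γ ^ 2) * g - (X 0 - γ ^ 2 * P 0)) ^ 2 = tangency γ P X := fun g => by
    change dist !₂[g, 0] X = γ * dist !₂[g, 0] P ↔ _
    rw [dist_comm _ X, dist_comm _ P, ← sq_eq_sq₀ dist_nonneg (by positivity), mul_pow,
      dist_axis_sq, dist_axis_sq, eq_comm, ← sub_eq_zero]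
    change margin γ P X g = 0 ↔ _
    rw [eq_comm (b := tangency γ P X), ← sub_eq_zero (a := tangency γ P X), ← margin_mul,
      mul_eq_zero, or_iff_right hpos.ne']
  rw [Set.mem_ofPred_eq, mem_tangencyCurve]
  simp only [hmem]
  constructor
  · intro ht
    rw [ht]
    refine ⟨(X 0 - γ ^ 2 * P 0) / (1 - γ ^ 2), ?_, fun g hg => ?_⟩
    · dsimp only
      rw [mul_div_cancel₀ _ hpos.ne', sub_self]
      norm_num
    · rw [eq_div_iff hpos.ne', mul_comm]
      exact sub_eq_zero.1 (pow_eq_zero_iff two_ne_zero |>.1 hg)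
  · rintro ⟨g, hg, huniq⟩
    dsimp only at hg huniq
    -- The mirror image of `g` in the vertex is also a solution, so uniqueness puts `g` at the
    -- vertex.
    have h1 := huniq ((2 * (X 0 - γ ^ 2 * P 0) - (1 - γ ^ 2) * g) / (1 - γ ^ 2)) (by
      rw [mul_div_cancel₀ _ hpos.ne', ← hg]
      ring)
    rw [div_eq_iff hpos.ne'] at h1
    rw [← hg]
    have : (1 - γ ^ 2) * g - (X 0 - γ ^ 2 * P 0) = 0 := by linarith
    rw [this]
    norm_num

end FootballGame

/-! ### Assembly of the cross-section -/

theorem corollary2 (vE v₁ v₂ xbar γ₁ γ₂ γ : ℝ) (P₁ P₂ : Plane) (xᵢ : ℝ)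
    (hvE : 0 < vE) (hv₁ : vE < v₁) (hv₂ : v₁ < v₂) (hxbar : 0 < xbar)
    (hγ₁ : γ₁ = vE / v₁) (hγ₂ : γ₂ = vE / v₂) (hγ : γ = v₁ / v₂)
    (hP₁ : P₁ ∈ field xbar) (hP₂ : P₂ ∈ field xbar)
    (hleft : dist P₁ !₂[0, 0] / v₁ ≤ dist P₂ !₂[0, 0] / v₂)
    (hright : dist P₂ !₂[xbar, 0] / v₂ ≤ dist P₁ !₂[xbar, 0] / v₁)
    (hxᵢ : xᵢ = xI γ P₁ P₂) :
    -- the cross-section of the Barrier surface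
    crossSection (barrier vE v₁ v₂ xbar) P₁ P₂ =
      {X | X ∈ field xbar ∧
        ((X 0 ≤ γ₁ ^ 2 * P₁ 0 ∧ X ∈ goalCircle γ₁ 0 P₁) ∨
         (γ₁ ^ 2 * P₁ 0 < X 0 ∧ X 0 ≤ (1 - γ₁ ^ 2) * xᵢ + γ₁ ^ 2 * P₁ 0 ∧
            X ∈ tangencyCurve γ₁ P₁) ∨
         ((1 - γ₁ ^ 2) * xᵢ + γ₁ ^ 2 * P₁ 0 < X 0 ∧ X 0 ≤ (1 - γ₂ ^ 2) * xᵢ + γ₂ ^ 2 * P₂ 0 ∧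
            X ∈ goalCircle γ₁ xᵢ P₁) ∨
         ((1 - γ₂ ^ 2) * xᵢ + γ₂ ^ 2 * P₂ 0 < X 0 ∧ X 0 ≤ (1 - γ₂ ^ 2) * xbar + γ₂ ^ 2 * P₂ 0 ∧
            X ∈ tangencyCurve γ₂ P₂) ∨
         ((1 - γ₂ ^ 2) * xbar + γ₂ ^ 2 * P₂ 0 < X 0 ∧ X ∈ goalCircle γ₂ xbar P₂))} ∧
    -- the curves are circles and hyperbolas, unless a pursuer is on the goal line
    (0 < P₁ 1 → IsCircle (goalCircle γ₁ 0 P₁) !₂[0, 0] ∧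
      IsCircle (goalCircle γ₁ xᵢ P₁) !₂[xᵢ, 0] ∧ IsHyperbola (tangencyCurve γ₁ P₁)) ∧
    (0 < P₂ 1 → IsCircle (goalCircle γ₂ xbar P₂) !₂[xbar, 0] ∧
      IsHyperbola (tangencyCurve γ₂ P₂)) ∧
    -- the circles are different when their centers are, and the hyperbolas are different
    0 ≤ xᵢ ∧ xᵢ ≤ xbar ∧
    goalCircle γ₁ 0 P₁ ≠ goalCircle γ₂ xbar P₂ ∧
    (0 < xᵢ → goalCircle γ₁ 0 P₁ ≠ goalCircle γ₁ xᵢ P₁) ∧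
    (xᵢ < xbar → goalCircle γ₁ xᵢ P₁ ≠ goalCircle γ₂ xbar P₂) ∧
    tangencyCurve γ₁ P₁ ≠ tangencyCurve γ₂ P₂ ∧
    -- the hyperbolas are the conditions for tangency of the Apollonius circles to the axis `y = 0`
    tangencyCurve γ₁ P₁ = {X | ∃! g : ℝ, !₂[g, 0] ∈ apolloniusCircle γ₁ P₁ X} ∧
    tangencyCurve γ₂ P₂ = {X | ∃! g : ℝ, !₂[g, 0] ∈ apolloniusCircle γ₂ P₂ X} := by
  have hv₁0 : 0 < v₁ := hvE.trans hv₁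
  have hv₂0 : 0 < v₂ := hv₁0.trans hv₂
  have hγ₁0 : 0 < γ₁ := hγ₁ ▸ div_pos hvE hv₁0
  have hγ₂0 : 0 < γ₂ := hγ₂ ▸ div_pos hvE hv₂0
  have hγ0 : 0 < γ := hγ ▸ div_pos hv₁0 hv₂0
  have hγ1 : γ < 1 := hγ ▸ (div_lt_one hv₂0).2 hv₂
  have hγ₁1 : γ₁ < 1 := hγ₁ ▸ (div_lt_one hv₁0).2 hv₁
  have hmul : γ₂ = γ * γ₁ := by rw [hγ₁, hγ₂, hγ]; field_simp
  have hγ₂₁ : γ₂ < γ₁ := by rw [hmul]; exact mul_lt_of_lt_one_left hγ₁0 hγ1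
  have hsq : γ ^ 2 < 1 := pow_lt_one₀ hγ0.le hγ1 two_ne_zero
  have hsq₁ : γ₁ ^ 2 < 1 := pow_lt_one₀ hγ₁0.le hγ₁1 two_ne_zero
  have hsq₂ : γ₂ ^ 2 < 1 := pow_lt_one₀ hγ₂0.le (hγ₂₁.trans hγ₁1) two_ne_zero
  have hleft' : dist P₁ !₂[0, 0] ≤ γ * dist P₂ !₂[0, 0] := by
    rw [div_le_iff₀ hv₁0] at hleft
    rw [hγ]
    exact hleft.trans_eq (by ring)
  have hright' : γ * dist P₂ !₂[xbar, 0] ≤ dist P₁ !₂[xbar, 0] := by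
    rw [le_div_iff₀ hv₁0] at hright
    rw [hγ]
    exact le_of_eq_of_le (by ring) hright
  have hl := pow_le_pow_left₀ dist_nonneg hleft' 2
  have hr := pow_le_pow_left₀ (by positivity) hright' 2
  rw [mul_pow, dist_axis_sq, dist_axis_sq] at hl hr
  obtain ⟨hx0, hxb, hxe, hN₁, hN₂⟩ := xI_spec hsq hxbar hl hr
  rw [← hxᵢ] at hx0 hxb hxe hN₁ hN₂
  refine ⟨?_, fun h => ⟨isCircle_goalCircle hγ₁0 0 h, isCircle_goalCircle hγ₁0 xᵢ h,
    isHyperbola_tangencyCurve hγ₁0 hγ₁1 h⟩, fun h => ⟨isCircle_goalCircle hγ₂0 xbar h,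
    isHyperbola_tangencyCurve hγ₂0 (hγ₂₁.trans hγ₁1) h⟩, hx0, hxb,
    fun h => hxbar.ne (center_eq_of_goalCircle_eq h),
    fun hlt h => hlt.ne (center_eq_of_goalCircle_eq h),
    fun hlt h => hlt.ne (center_eq_of_goalCircle_eq h),
    tangencyCurve_ne hγ₂0 hγ₂₁ hsq₁ _ _, tangencyCurve_eq hγ₁0 hsq₁ _,
    tangencyCurve_eq hγ₂0 hsq₂ _⟩
  ext X
  change (X, P₁, P₂) ∈ barrier vE v₁ v₂ xbar ↔ _
  rw [mem_barrier_iff hvE hv₁ (hv₁.trans hv₂), Set.mem_ofPred_eq]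
  have hplay : (X, P₁, P₂) ∈ playStates xbar ↔ X ∈ field xbar :=
    ⟨fun h => h.1, fun h => ⟨h, hP₁, hP₂⟩⟩
  rw [hplay]
  refine and_congr_right fun _ => ?_
  simp only [goal_eq_image, Set.forall_mem_image, Set.exists_mem_image,
    ← margin_nonneg_iff hvE hv₁0, ← margin_nonneg_iff hvE hv₂0,
    ← margin_nonpos_iff hvE hv₁0, ← margin_nonpos_iff hvE hv₂0, ← hγ₁, ← hγ₂]
  -- The terms in `X` cancel: which margin is smaller depends on the pursuers alone.
  have hdiff : ∀ g, margin γ₁ P₁ X g - margin γ₂ P₂ X g = γ₁ ^ 2 *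
      ((P₁ 0 - g) ^ 2 + P₁ 1 ^ 2 - γ ^ 2 * ((P₂ 0 - g) ^ 2 + P₂ 1 ^ 2)) := fun g => by
    rw [hmul]; unfold margin; ring
  have h₁ : ∀ g ∈ Set.Icc 0 xᵢ, margin γ₁ P₁ X g ≤ margin γ₂ P₂ X g := fun g hg => by
    rw [← sub_nonpos, hdiff]
    exact mul_nonpos_of_nonneg_of_nonpos (sq_nonneg _) (sub_nonpos.2 (hN₁ g hg))
  have h₂ : ∀ g ∈ Set.Icc xᵢ xbar, margin γ₂ P₂ X g ≤ margin γ₁ P₁ X g := fun g hg => by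
    rw [← sub_nonneg, hdiff]
    exact mul_nonneg (sq_nonneg _) (sub_nonneg.2 (hN₂ g hg.1))
  have hI : margin γ₁ P₁ X xᵢ = margin γ₂ P₂ X xᵢ :=
    le_antisymm (h₁ _ ⟨hx0, le_rfl⟩) (h₂ _ ⟨le_rfl, hxb⟩)
  have ht₀₁ : γ₁ ^ 2 * P₁ 0 ≤ (1 - γ₁ ^ 2) * xᵢ + γ₁ ^ 2 * P₁ 0 :=
    le_add_of_nonneg_left (mul_nonneg (by linarith) hx0)
  -- This is where the choice of the right root matters: if the vertex of the second margin lies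
  -- beyond `xᵢ`, so does that of the first.
  have ht₁₂ : (1 - γ₁ ^ 2) * xᵢ + γ₁ ^ 2 * P₁ 0 ≤ (1 - γ₂ ^ 2) * xᵢ + γ₂ ^ 2 * P₂ 0 := by
    rw [hmul]
    linear_combination γ₁ ^ 2 * hxe
  have ht₂₃ : (1 - γ₂ ^ 2) * xᵢ + γ₂ ^ 2 * P₂ 0 ≤ (1 - γ₂ ^ 2) * xbar + γ₂ ^ 2 * P₂ 0 := by
    have := mul_le_mul_of_nonneg_left hxb (by linarith : 0 ≤ 1 - γ₂ ^ 2)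
    linarith
  have hmax := fun k => forall_exists_iff_max_eq_zero (k := k) hx0 hxb h₁ h₂
  simp only [mem_goalCircle, mem_tangencyCurve]
  refine iff_piecewise ht₀₁ ht₁₂ ht₂₃ ?_ ?_ ?_ ?_ ?_
  -- Both margins decrease on their pieces: the maximum is at `0`.
  · intro c₀
    have ha : X 0 ≤ (1 - γ₁ ^ 2) * 0 + γ₁ ^ 2 * P₁ 0 := by linarith
    rw [hmax (margin γ₁ P₁ X 0) (fun g hg => margin_le_of_right hsq₁ hg.1 ha)
      (fun g hg => (margin_le_of_right hsq₂ hg.1 (by linarith)).trans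
        (hI ▸ margin_le_of_right hsq₁ hx0 ha)) (Or.inl ⟨0, ⟨le_rfl, hx0⟩, rfl⟩)]
  -- The vertex of the first margin lies in `[0, xᵢ]`, and the second margin decreases beyond `xᵢ`.
  · intro c₀ c₁
    rw [hmax (tangency γ₁ P₁ X / (1 - γ₁ ^ 2)) (fun g _ => margin_le_vertex hsq₁ _ _ _)
      (fun g hg => (margin_le_of_right hsq₂ hg.1 (by linarith)).trans
        (hI ▸ margin_le_vertex hsq₁ _ _ _))
      (Or.inl ⟨_, ⟨div_nonneg (by linarith) (by linarith),
        (div_le_iff₀ (by linarith)).2 (by linarith)⟩, margin_vertex hsq₁ _ _⟩),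
      div_eq_zero_iff, or_iff_left (by linarith)]
  -- The first margin increases up to the crossing and the second decreases after it.
  · intro c₁ c₂
    rw [hmax (margin γ₁ P₁ X xᵢ) (fun g hg => margin_le_of_left hsq₁ hg.2 c₁.le)
      (fun g hg => hI ▸ margin_le_of_right hsq₂ hg.1 c₂) (Or.inl ⟨xᵢ, ⟨hx0, le_rfl⟩, rfl⟩)]
  -- The first margin increases up to `xᵢ`, and the vertex of the second lies in `[xᵢ, xbar]`.
  · intro c₂ c₃
    have c₁ := ht₁₂.trans_lt c₂
    rw [hmax (tangency γ₂ P₂ X / (1 - γ₂ ^ 2))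
      (fun g hg => (margin_le_of_left hsq₁ hg.2 c₁.le).trans
        (hI ▸ margin_le_vertex hsq₂ _ _ _)) (fun g _ => margin_le_vertex hsq₂ _ _ _)
      (Or.inr ⟨_, ⟨(le_div_iff₀ (by linarith)).2 (by linarith),
        (div_le_iff₀ (by linarith)).2 (by linarith)⟩, margin_vertex hsq₂ _ _⟩),
      div_eq_zero_iff, or_iff_left (by linarith)]
  -- Both margins increase on their pieces: the maximum is at `xbar`.
  · intro c₃
    have c₂ := ht₂₃.trans_lt c₃
    have c₁ := ht₁₂.trans_lt c₂
    rw [hmax (margin γ₂ P₂ X xbar)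
      (fun g hg => (margin_le_of_left hsq₁ hg.2 c₁.le).trans
        (hI ▸ margin_le_of_left hsq₂ hxb c₃.le))
      (fun g hg => margin_le_of_left hsq₂ hg.2 c₃.le) (Or.inr ⟨xbar, ⟨hxb, le_rfl⟩, rfl⟩)]
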